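/- For a cardinal $\kappa$, a right module over an associative unital ring is called $<\kappa$-generated if it has a set of generators of cardinality less than $\kappa$; a ring $R$ is called right $<\kappa$-Noetherian if every submodule of a $<\kappa$-generated right $R$-module is $<\kappa$-generated. A right $R$-module $M$ is called injectively resolved if there exists an exact sequence of right $R$-modules $\cdots\to J_2\to J_1\to J_0\to M\to 0$ in which all the modules $J_n$, $n\ge 0$, are injective. For cardinals $\nu$ and $\lambda$, put $\nu^{<\lambda}=\sup_{\mu<\lambda}\nu^{\mu}$, where $\mu$ ranges over the cardinals smaller than $\lambda$, and let $\nu^+$ denote the successor cardinal of $\nu$. A poset is called $\nu^+$-directed if each of its subsets of cardinality less than $\nu^+$ has an upper bound. Corollary. Let $\lambda$ be a regular cardinal and let $R$ be a right $<\lambda$-Noetherian ring. Let $\nu$ be a cardinal such that $|R|+\aleph_0\le\nu$ and $\nu^{<\lambda}=\nu$. Then every injectively resolved right $R$-module is the colimit, in the category of right $R$-modules, of a diagram indexed by a $\nu^+$-directed poset whose terms are injectively resolved right $R$-modules of cardinality at most $\nu$. -/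

import Mathlib

open CategoryTheory CategoryTheory.Limits
open scoped Cardinal

universe u

/-- A submodule `N` is `<κ`-generated if it is spanned by a set of cardinality less than `κ`. -/
def IsLTGenerated (κ : Cardinal.{u}) {A M : Type u} [Ring A] [AddCommGroup M] [Module A M]
    (N : Submodule A M) : Prop :=
  ∃ S : Set M, #S < κ ∧ Submodule.span A S = N

/-- A ring `R` is right `<κ`-Noetherian if every submodule of a `<κ`-generated right
`R`-module is `<κ`-generated. Right `R`-modules are modules over `Rᵐᵒᵖ`. -/
def IsRightLTNoetherian (κ : Cardinal.{u}) (R : Type u) [Ring R] : Prop :=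
  ∀ (M : Type u) [AddCommGroup M] [Module Rᵐᵒᵖ M],
    IsLTGenerated κ (⊤ : Submodule Rᵐᵒᵖ M) →
      ∀ N : Submodule Rᵐᵒᵖ M, IsLTGenerated κ N

/-- A module `M` is injectively resolved if there is an exact sequence
`⋯ → J₂ → J₁ → J₀ → M → 0` with all `Jₙ` injective. -/
def IsInjectivelyResolved (A M : Type u) [Ring A] [AddCommGroup M] [Module A M] : Prop :=
  ∃ (J : ℕ → ModuleCat.{u} A) (d : ∀ n, J (n + 1) →ₗ[A] J n) (ε : J 0 →ₗ[A] M),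
    (∀ n, Module.Injective A (J n)) ∧
    (∀ n, Function.Exact (d (n + 1)) (d n)) ∧
    Function.Exact (d 0) ε ∧
    Function.Surjective ε

/-- A poset is `κ`-directed if every subset of cardinality less than `κ` has an upper bound
(in particular, for `κ > 0`, it is nonempty). -/
def IsKDirected (κ : Cardinal.{u}) (Ξ : Type u) [PartialOrder Ξ] : Prop :=
  ∀ S : Set Ξ, #S < κ → BddAbove S

/-! A Löwenheim–Skolem argument. A set of at most `ν` elements of `∏ J n` is closed under at most
`ν` operations of arity below `lam`; since `ν ^< lam = ν`, the closure still has size at most `ν`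
(`exists_closed_superset`). Chosen preimages under the differentials keep the components exact.
Chosen solutions of systems of fewer than `lam` linear equations keep them injective, by Baer's
criterion (`injective_map_proj`). So small injectively resolved submodules absorb every subset of
`M` of size at most `ν`: they are `ν⁺`-directed with union `M`. -/

namespace Cardinal

/-- A set of arities containing, up to bijection, every cardinal below `κ`. -/
def Arity (κ : Cardinal.{u}) (i : κ.ord.ToType) : Type u := i.toOrd.1.ToType

theorem mk_arity_lt {κ : Cardinal.{u}} (i : κ.ord.ToType) : #(Arity κ i) < κ := by
  have h : i.toOrd.1 < κ.ord := i.toOrd.2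
  simpa [Arity] using lt_ord.1 h

theorem exists_range_arity_eq {κ : Cardinal.{u}} {α : Type u} (S : Set α) (hS : #S < κ) :
    ∃ (i : κ.ord.ToType) (a : Arity κ i → α), Set.range a = S := by
  refine ⟨Ordinal.ToType.mk ⟨(#S).ord, ord_lt_ord.2 hS⟩, ?_⟩
  have h : #(Arity κ (Ordinal.ToType.mk ⟨(#S).ord, ord_lt_ord.2 hS⟩)) = #S := by
    simp [Arity]
  obtain ⟨e⟩ := Cardinal.eq.1 h
  exact ⟨fun j ↦ (e j : α), by
    rw [show (fun j ↦ (e j : α)) = Subtype.val ∘ e from rfl, e.surjective.range_comp,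
      Subtype.range_coe]⟩

theorem le_of_powerlt_eq {κ ν : Cardinal.{u}} (hν : ℵ₀ ≤ ν) (hpow : ν ^< κ = ν) : κ ≤ ν := by
  by_contra! h
  have h1 : ν ^ ν ≤ ν := (le_powerlt ν h).trans_eq hpow
  have h2 : ν < ν ^ ν := (cantor ν).trans_le
    (power_le_power_right ((natCast_lt_aleph0 (n := 2)).le.trans hν))
  exact absurd h1 h2.not_ge

/-- The closure of a small set under a small family of operations of arity less than `κ`
is small. -/
theorem exists_closed_superset {κ ν : Cardinal.{u}} (hν : ℵ₀ ≤ ν) (hpow : ν ^< κ = ν)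
    {W Op : Type u} (hOp : #Op ≤ ν) (β : Op → Type u) (hβ : ∀ o, #(β o) < κ)
    (op : ∀ o, (β o → W) → W) (X : Set W) (hX : #X ≤ ν) :
    ∃ Y : Set W, X ⊆ Y ∧ #Y ≤ ν ∧ ∀ o (x : β o → W), (∀ j, x j ∈ Y) → op o x ∈ Y := by
  -- The closure consists of the values of well-founded terms, with elements of `X` as constants;
  -- bounding it amounts to counting a W-type.
  let B : X ⊕ Op → Type u := Sum.elim (fun _ ↦ PEmpty) β
  let stp : (Σ a, B a → W) → W := fun p ↦ match p with
    | ⟨.inl x, _⟩ => x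
    | ⟨.inr o, f⟩ => op o f
  refine ⟨Set.range (WType.elim W stp), fun x hx ↦ ⟨.mk (.inl ⟨x, hx⟩) PEmpty.elim, rfl⟩, ?_, ?_⟩
  · refine mk_range_le.trans (WType.cardinalMk_le_of_le ?_)
    have hB : ∀ a, ν ^ #(B a) ≤ ν := by
      rintro (x | o)
      · simpa [B] using one_le_aleph0.trans hν
      · exact (le_powerlt ν (hβ o)).trans_eq hpow
    calc (sum fun a ↦ ν ^ #(B a)) ≤ sum fun _ : X ⊕ Op ↦ ν := sum_le_sum _ _ hB
      _ = #(X ⊕ Op) * ν := sum_const' _ _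
      _ ≤ ν * ν := mul_le_mul_left (by
          simpa using (add_le_add hX hOp).trans_eq (add_eq_self hν)) _
      _ = ν := mul_eq_self hν
  · intro o x hx
    choose t ht using hx
    refine ⟨.mk (.inr o) t, ?_⟩
    change op o _ = _
    congr 1
    exact funext ht

end Cardinal

open Cardinal

/-- The regular module is generated by `1`. -/
theorem IsRightLTNoetherian.ideal {R : Type u} [Ring R] {lam : Cardinal.{u}}
    (hlam : 1 < lam) (hR : IsRightLTNoetherian lam R) (I : Ideal Rᵐᵒᵖ) :
    IsLTGenerated lam I :=
  hR Rᵐᵒᵖ ⟨{1}, by simpa using hlam, Ideal.span_singleton_one⟩ I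

namespace InjectiveResolution

section Operations

variable {A : Type u} [Ring A] (J : ℕ → Type u) [∀ n, AddCommGroup (J n)] [∀ n, Module A (J n)]

/-- Componentwise, a chosen solution `y` of the system `a j • y = x j`, if there is one. -/
noncomputable def solve {β : Type u} (a : β → A) (x : β → ∀ n, J n) (n : ℕ) : J n :=
  Function.extend (fun (y : J n) (j : β) ↦ a j • y) id 0 (fun j ↦ x j n)

theorem smul_solve {β : Type u} (a : β → A) (x : β → ∀ n, J n) (n : ℕ)
    (h : ∃ y : J n, ∀ j, a j • y = x j n) (j : β) : a j • solve J a x n = x j n := by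
  classical
  obtain ⟨y, hy⟩ := h
  have h' : ∃ y : J n, (fun j ↦ a j • y) = fun j ↦ x j n := ⟨y, funext hy⟩
  rw [solve, Function.extend_def, dif_pos h']
  exact congrFun h'.choose_spec j

variable {J} (d : ∀ n, J (n + 1) →ₗ[A] J n)

/-- Componentwise, a chosen preimage under the differential. -/
noncomputable def lift (x : ∀ n, J n) : ∀ n, J n
  -- Preimages live one degree higher, so degree 0 gets a filler.
  | 0 => 0
  | n + 1 => Function.invFun (d n) (x n)

theorem d_lift (x : ∀ n, J n) (n : ℕ) (h : ∃ y, d n y = x n) : d n (lift d x (n + 1)) = x n :=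
  Function.invFun_eq h

/-- A small subset of the product of the `J n` lies in a small submodule closed under the shifted
differential, `lift` and `solve`. -/
theorem exists_closed_submodule {lam ν : Cardinal.{u}} (hlam : ℵ₀ ≤ lam) (hν : ℵ₀ ≤ ν)
    (hA : #A ≤ ν) (hpow : ν ^< lam = ν) (X : Set (∀ n, J n)) (hX : #X ≤ ν) :
    ∃ Y : Submodule A (∀ n, J n), X ⊆ Y ∧ #Y ≤ ν ∧
      (∀ x ∈ Y, (fun n ↦ d n (x (n + 1))) ∈ Y) ∧ (∀ x ∈ Y, lift d x ∈ Y) ∧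
      ∀ (i : lam.ord.ToType) (a : Arity lam i → A) (x : Arity lam i → ∀ n, J n),
        (∀ j, x j ∈ Y) → solve J a x ∈ Y := by
  let Un := A ⊕ ULift.{u} Bool
  let In := Σ i : lam.ord.ToType, Arity lam i → A
  -- `none` is addition; the two flags in `Un` are the differential and `lift`.
  let Op := Option (Un ⊕ In)
  let β : Op → Type u := fun o ↦ match o with
    | none => ULift.{u} Bool
    | some (.inl _) => PUnit
    | some (.inr ia) => Arity lam ia.1
  let op : ∀ o, (β o → ∀ n, J n) → ∀ n, J n := fun o ↦ match o with
    | none => fun x ↦ x ⟨false⟩ + x ⟨true⟩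
    | some (.inl (.inl r)) => fun x ↦ r • x ⟨⟩
    | some (.inl (.inr ⟨false⟩)) => fun x n ↦ d n (x ⟨⟩ (n + 1))
    | some (.inl (.inr ⟨true⟩)) => fun x ↦ lift d (x ⟨⟩)
    | some (.inr ia) => solve J ia.2
  have hlt : ∀ n : ℕ, (n : Cardinal) < lam := fun n ↦ (natCast_lt_aleph0).trans_le hlam
  have hβ : ∀ o, #(β o) < lam := by
    rintro (_ | _ | ⟨i, a⟩)
    · simpa [β] using hlt 2
    · simpa [β] using hlt 1
    · exact mk_arity_lt i
  have hUn : #Un ≤ ν := by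
    have : #Un = #A + 2 := by simp [Un]
    rw [this]
    exact (add_le_add hA ((natCast_lt_aleph0 (n := 2)).le.trans hν)).trans_eq (add_eq_self hν)
  have hIn : #In ≤ ν := by
    calc #In = sum fun i : lam.ord.ToType ↦ #A ^ #(Arity lam i) := by simp [In]
      _ ≤ sum fun _ : lam.ord.ToType ↦ ν := sum_le_sum _ _ fun i ↦
          (power_le_power_right hA).trans ((le_powerlt ν (mk_arity_lt i)).trans_eq hpow)
      _ = lam * ν := by rw [sum_const']; simp
      _ ≤ ν * ν := mul_le_mul_left (le_of_powerlt_eq hν hpow) _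
      _ = ν := mul_eq_self hν
  have hOp : #Op ≤ ν := by
    have : #Op = #Un + #In + 1 := by simp [Op]
    rw [this]
    exact (add_le_add ((add_le_add hUn hIn).trans_eq (add_eq_self hν))
      (one_le_aleph0.trans hν)).trans_eq (add_eq_self hν)
  obtain ⟨Y, hXY, hY, hcl⟩ := exists_closed_superset hν hpow hOp β hβ op (insert 0 X)
    ((mk_insert_le).trans ((add_le_add hX (one_le_aleph0.trans hν)).trans_eq (add_eq_self hν)))
  refine ⟨{ carrier := Y
            zero_mem' := hXY (Set.mem_insert _ _)
            add_mem' := fun {x y} hx hy ↦ hcl none (fun b ↦ bif b.down then y else x) ?_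
            smul_mem' := fun r x hx ↦ hcl (some (.inl (.inl r))) (fun _ ↦ x) fun _ ↦ hx },
    fun x hx ↦ hXY (Set.mem_insert_of_mem _ hx), hY,
    fun x hx ↦ hcl (some (.inl (.inr ⟨false⟩))) (fun _ ↦ x) fun _ ↦ hx,
    fun x hx ↦ hcl (some (.inl (.inr ⟨true⟩))) (fun _ ↦ x) fun _ ↦ hx,
    fun i a x hx ↦ hcl (some (.inr ⟨i, a⟩)) x hx⟩
  rintro ⟨_ | _⟩
  exacts [hx, hy]

/-- If all ideals are `<lam`-generated, then a component of a submodule closed under `solve`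
is injective as soon as the ambient module is. -/
theorem injective_map_proj {lam : Cardinal.{u}} (hI : ∀ I : Ideal A, IsLTGenerated lam I)
    (Y : Submodule A (∀ n, J n))
    (hY : ∀ (i : lam.ord.ToType) (a : Arity lam i → A) (x : Arity lam i → ∀ n, J n),
        (∀ j, x j ∈ Y) → solve J a x ∈ Y) (n : ℕ) (hJ : Module.Injective A (J n)) :
    Module.Injective A (Y.map (LinearMap.proj n : (∀ n, J n) →ₗ[A] J n)) := by
  refine Module.Baer.injective fun I g ↦ ?_
  obtain ⟨S, hS, hSI⟩ := hI I
  obtain ⟨i, a, rfl⟩ := exists_range_arity_eq S hS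
  have ha : ∀ j, a j ∈ I := fun j ↦ hSI ▸ Submodule.subset_span ⟨j, rfl⟩
  choose x hxY hx using fun j ↦ (g ⟨a j, ha j⟩).2
  -- Injectivity of `J n` is used only to see that the system is solvable there, by `g' 1`; closure
  -- under `solve` then gives a solution inside `Y`.
  obtain ⟨g', hg'⟩ := Module.Baer.of_injective hJ I ((Submodule.subtype _).comp g)
  have hsol : ∀ j, a j • solve J a x n = x j n := smul_solve J a x n
    ⟨g' 1, fun j ↦ by
      rw [← map_smul, smul_eq_mul, mul_one, hg' _ (ha j)]
      exact (hx j).symm⟩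
  let y : Y.map (LinearMap.proj n : (∀ n, J n) →ₗ[A] J n) :=
    ⟨solve J a x n, solve J a x, hY i a x hxY, rfl⟩
  refine ⟨LinearMap.toSpanSingleton A _ y, ?_⟩
  suffices h : ∀ r (hr : r ∈ Submodule.span A (Set.range a)), ∃ h : r ∈ I, r • y = g ⟨r, h⟩ from
    fun r hr ↦ (h r (hSI ▸ hr)).2
  intro r hr
  induction hr using Submodule.span_induction with
  | mem r hr =>
    obtain ⟨j, rfl⟩ := hr
    exact ⟨ha j, Subtype.ext ((hsol j).trans (hx j))⟩
  | zero => exact ⟨I.zero_mem, by rw [zero_smul]; exact (map_zero g).symm⟩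
  | add r s _ _ hr hs =>
    obtain ⟨h1, h2⟩ := hr
    obtain ⟨h3, h4⟩ := hs
    exact ⟨I.add_mem h1 h3, by rw [add_smul, h2, h4, ← map_add]; rfl⟩
  | smul c r _ hr =>
    obtain ⟨h1, h2⟩ := hr
    exact ⟨I.mul_mem_left c h1, by rw [smul_assoc, h2, ← map_smul]; rfl⟩

end Operations

end InjectiveResolution

open InjectiveResolution in
/-- Every small subset of an injectively resolved module lies in a small injectively resolved
submodule. -/
theorem IsInjectivelyResolved.exists_submodule {A M : Type u} [Ring A] [AddCommGroup M]
    [Module A M] (hM : IsInjectivelyResolved A M) {lam ν : Cardinal.{u}} (hlam : ℵ₀ ≤ lam)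
    (hν : ℵ₀ ≤ ν) (hA : #A ≤ ν) (hpow : ν ^< lam = ν) (hI : ∀ I : Ideal A, IsLTGenerated lam I)
    (X : Set M) (hX : #X ≤ ν) :
    ∃ N : Submodule A M, X ⊆ N ∧ #N ≤ ν ∧ IsInjectivelyResolved A N := by
  obtain ⟨J, d, ε, hJ, hd, hε, hsurj⟩ := hM
  -- Each `m` is coded by a preimage under `ε`, placed in degree 0.
  let s : M → ∀ n, J n := fun m ↦ Pi.single 0 (Function.surjInv hsurj m)
  obtain ⟨Y, hXY, hYν, hYd, hYl, hYs⟩ := exists_closed_submodule (J := fun n ↦ J n) d hlam hν hA hpow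
    (s '' X) (mk_image_le.trans hX)
  let p : ∀ n, (∀ n, J n) →ₗ[A] J n := fun n ↦ LinearMap.proj n
  let K : ∀ n, Submodule A (J n) := fun n ↦ Y.map (p n)
  have hK : ∀ n, ∀ x ∈ K (n + 1), d n x ∈ K n := by
    rintro n _ ⟨x, hx, rfl⟩
    exact ⟨_, hYd x hx, rfl⟩
  have hKl : ∀ n, ∀ x ∈ K n, (∃ y, d n y = x) → ∃ y ∈ K (n + 1), d n y = x := by
    rintro n _ ⟨x, hx, rfl⟩ h
    exact ⟨_, ⟨_, hYl x hx, rfl⟩, d_lift (J := fun n ↦ J n) d x n h⟩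
  let N : Submodule A M := (K 0).map ε
  refine ⟨N, fun m hm ↦ ⟨s m 0, ⟨s m, hXY ⟨m, hm, rfl⟩, rfl⟩, ?_⟩,
    (mk_image_le.trans mk_image_le).trans hYν,
    fun n ↦ ModuleCat.of A (K n), fun n ↦ (d n).restrict (hK n),
    ε.restrict fun x hx ↦ Submodule.mem_map_of_mem hx,
    fun n ↦ injective_map_proj (J := fun n ↦ J n) hI Y hYs n (hJ n), fun n ↦ ?_, ?_, ?_⟩
  · simpa [s] using Function.surjInv_eq hsurj m
  · intro x
    constructor
    · intro hx
      obtain ⟨y, hy, hyx⟩ := hKl _ x.1 x.2 ((hd n x.1).1 (congrArg Subtype.val hx))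
      exact ⟨⟨y, hy⟩, Subtype.ext hyx⟩
    · rintro ⟨y, rfl⟩
      exact Subtype.ext ((hd n).apply_apply_eq_zero y.1)
  · intro x
    constructor
    · intro hx
      obtain ⟨y, hy, hyx⟩ := hKl _ x.1 x.2 ((hε x.1).1 (congrArg Subtype.val hx))
      exact ⟨⟨y, hy⟩, Subtype.ext hyx⟩
    · rintro ⟨y, rfl⟩
      exact Subtype.ext (hε.apply_apply_eq_zero y.1)
  · rintro ⟨_, x, hx, rfl⟩
    exact ⟨⟨x, hx⟩, rfl⟩

namespace ModuleCat

variable {A : Type u} [Ring A] {M : ModuleCat.{u} A} (P : Set (Submodule A M))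

/-- The diagram of the members of a set of submodules and their inclusions. -/
def submodules : P ⥤ ModuleCat.{u} A where
  obj N := of A N.1
  map f := ofHom (Submodule.inclusion (leOfHom f))

/-- The inclusions of submodules, as a cocone. -/
def submodulesCocone : Cocone (submodules P) where
  pt := M
  ι := { app N := ofHom N.1.subtype }

variable {P}

/-- A module is the colimit of any directed set of submodules covering it. -/
theorem nonempty_isColimit_submodulesCocone (hdir : DirectedOn (· ≤ ·) P)
    (hP : ∀ m : M, ∃ N ∈ P, m ∈ N) : Nonempty (IsColimit (submodulesCocone P)) := by
  choose N hNP hN using hP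
  -- By directedness, the choice of `N m` does not affect the value at `m`.
  have key : ∀ (s : Cocone (submodules P)) (N₁ N₂ : P) (m : M) (h₁ : m ∈ N₁.1) (h₂ : m ∈ N₂.1),
      (s.ι.app N₁).hom ⟨m, h₁⟩ = (s.ι.app N₂).hom ⟨m, h₂⟩ := by
    have mono : ∀ (s : Cocone (submodules P)) (N₁ N₂ : P) (h : N₁ ≤ N₂) (m : N₁.1),
        (s.ι.app N₂).hom ⟨m.1, h m.2⟩ = (s.ι.app N₁).hom m := fun s N₁ N₂ h m ↦
      LinearMap.congr_fun (congrArg Hom.hom (s.w (homOfLE h))) m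
    intro s N₁ N₂ m h₁ h₂
    obtain ⟨N₃, h₃, h₁₃, h₂₃⟩ := hdir N₁.1 N₁.2 N₂.1 N₂.2
    rw [← mono s N₁ ⟨N₃, h₃⟩ h₁₃, ← mono s N₂ ⟨N₃, h₃⟩ h₂₃]
  let desc : ∀ s : Cocone (submodules P), M →ₗ[A] s.pt := fun s ↦
    { toFun := fun m ↦ (s.ι.app ⟨N m, hNP m⟩).hom ⟨m, hN m⟩
      map_add' := fun x y ↦ by
        obtain ⟨N₃, h₃, hx, hy⟩ := hdir _ (hNP x) _ (hNP y)
        have hx' := hx (hN x)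
        have hy' := hy (hN y)
        rw [key s _ ⟨N₃, h₃⟩ x (hN x) hx', key s _ ⟨N₃, h₃⟩ y (hN y) hy',
          key s _ ⟨N₃, h₃⟩ (x + y) (hN _) (N₃.add_mem hx' hy')]
        exact (s.ι.app ⟨N₃, h₃⟩).hom.map_add ⟨x, hx'⟩ ⟨y, hy'⟩
      map_smul' := fun r x ↦ by
        rw [key s _ ⟨N x, hNP x⟩ (r • x) (hN _) ((N x).smul_mem r (hN x))]
        exact (s.ι.app ⟨N x, hNP x⟩).hom.map_smul r ⟨x, hN x⟩ }
  refine ⟨{ desc := fun s ↦ ofHom (desc s), fac := fun s N₁ ↦ ?_, uniq := fun s f hf ↦ ?_ }⟩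
  · ext x
    exact key s _ N₁ x.1 (hN _) x.2
  · ext m
    exact LinearMap.congr_fun (congrArg Hom.hom (hf ⟨N m, hNP m⟩)) ⟨m, hN m⟩

end ModuleCat

theorem mainTheorem6 (R : Type u) [Ring R] (lam ν : Cardinal.{u})
    (hlam : lam.IsRegular) (hR : IsRightLTNoetherian lam R)
    (hν : #R + ℵ₀ ≤ ν) (hpow : ν ^< lam = ν)
    (M : ModuleCat.{u} Rᵐᵒᵖ) (hM : IsInjectivelyResolved Rᵐᵒᵖ M) :
    ∃ (Ξ : Type u) (_ : PartialOrder Ξ) (F : Ξ ⥤ ModuleCat.{u} Rᵐᵒᵖ) (ι : Cocone F),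
      IsKDirected (Order.succ ν) Ξ ∧
      (∀ ξ : Ξ, #(F.obj ξ) ≤ ν ∧ IsInjectivelyResolved Rᵐᵒᵖ (F.obj ξ)) ∧
      Nonempty (IsColimit ι) ∧ Nonempty (ι.pt ≅ M) := by
  have hν' : ℵ₀ ≤ ν := (self_le_add_left _ _).trans hν
  have hA : #Rᵐᵒᵖ ≤ ν :=
    (mk_congr MulOpposite.opEquiv.symm).le.trans ((self_le_add_right _ _).trans hν)
  have hex := fun X hX ↦ hM.exists_submodule hlam.aleph0_le hν' hA hpow
    (hR.ideal (one_lt_aleph0.trans_le hlam.aleph0_le)) X hX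
  let P : Set (Submodule Rᵐᵒᵖ M) := {N | #N ≤ ν ∧ IsInjectivelyResolved Rᵐᵒᵖ N}
  have hdir : IsKDirected (Order.succ ν) P := by
    intro S hS
    have hS' : #S ≤ ν := Order.lt_succ_iff.1 hS
    obtain ⟨N, hN, hNP⟩ := hex (⋃ K : S, (K.1.1 : Set M)) (by
      calc #(⋃ K : S, (K.1.1 : Set M)) ≤ sum fun K : S ↦ #K.1.1 := mk_iUnion_le_sum_mk
        _ ≤ sum fun _ : S ↦ ν := sum_le_sum _ _ fun K ↦ K.1.2.1
        _ = #S * ν := sum_const' _ _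
        _ ≤ ν * ν := mul_le_mul_left hS' _
        _ = ν := mul_eq_self hν')
    exact ⟨⟨N, hNP⟩, fun K hK ↦ (Set.subset_iUnion (fun K : S ↦ (K.1.1 : Set M)) ⟨K, hK⟩).trans hN⟩
  have hpair : DirectedOn (· ≤ ·) P := by
    intro N₁ h₁ N₂ h₂
    obtain ⟨N, hN⟩ := hdir {⟨N₁, h₁⟩, ⟨N₂, h₂⟩}
      (((Set.toFinite _).lt_aleph0.le.trans hν').trans_lt (Order.lt_succ ν))
    exact ⟨N.1, N.2, hN (Set.mem_insert _ _), hN (Set.mem_insert_of_mem _ rfl)⟩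
  refine ⟨P, inferInstance, ModuleCat.submodules P, ModuleCat.submodulesCocone P, hdir,
    fun N ↦ N.2, ModuleCat.nonempty_isColimit_submodulesCocone hpair fun m ↦ ?_, ⟨Iso.refl M⟩⟩
  obtain ⟨N, hN, hNP⟩ := hex {m} (by simpa using one_le_aleph0.trans hν')
  exact ⟨N, hNP, hN rfl⟩
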